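/- Consider a network of two parallel links with finite state space $\Omega$, a prior $\mu_0$ on $\Omega$ with $\mu_0(\omega)>0$ for all $\omega$, and polynomial latency functions $\ell_{\omega,i}(f)=\sum_{d=0}^{D}\alpha_{d,\omega,i}f^d$, $i\in\{1,2\}$, with real coefficients (in particular, all nonnegative non-decreasing latencies of this form). For $r\ge 0$ let $\mathcal P(r)=\{x\in\mathbb R_{\ge 0}^2: x_1+x_2=r\}$. Let $\nu\in[0,1]$ be the fraction of participating agents and let $y\in\mathcal P(1-\nu)$ be a fixed flow of the non-participating agents. A private signaling policy is a family $\pi=(\pi_\omega)_{\omega\in\Omega}$ of Borel probability measures on $\mathcal P(\nu)$. The problem for an optimal policy with non-participant flow $y$ is $$\min_{\pi}\ \sum_{\omega,i}\mu_0(\omega)\int (x_i+y_i)\,\ell_{\omega,i}(x_i+y_i)\,d\pi_\omega(x)$$ subject to, for all $i,j\in\{1,2\}$, $$\sum_\omega\mu_0(\omega)\int\big(\ell_{\omega,j}(x_j+y_j)-\ell_{\omega,i}(x_i+y_i)\big)\,x_i\,d\pi_\omega(x)\ge 0,\qquad \sum_\omega\mu_0(\omega)\int\big(\ell_{\omega,j}(x_j+y_j)-\ell_{\omega,i}(x_i+y_i)\big)\,y_i\,d\pi_\omega(x)\ge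 0 .$$ Let $z$ be the vector of all monomials in $x_1,x_2$ of degree at most $(D+1)/2$ if $D$ is odd and $D/2+1$ if $D$ is even. There are symmetric matrices $C_\omega, A^{(i,j)}_\omega, B^{(i,j)}_\omega$ (depending on $y$) such that on $\mathcal P(\nu)$ the three integrands above (including the factor $\mu_0(\omega)$) equal $C_\omega\cdot zz^T$, $A^{(i,j)}_\omega\cdot zz^T$, $B^{(i,j)}_\omega\cdot zz^T$, where $\cdot$ is the Frobenius inner product; for any such matrices the problem is the generalized problem of moments $$\min_\pi \sum_\omega\int C_\omega\cdot zz^T\,d\pi_\omega\quad\text{s.t.}\quad \sum_\omega\int A^{(i,j)}_\omega\cdot zz^T\,d\pi_\omega\ge 0,\quad \sum_\omega\int B^{(i,j)}_\omega\cdot zz^T\,d\pi_\omega\ge 0,\quad i,j\in\{1,2\}. \qquad (\mathrm{GPM})$$ Then (GPM) is equivalent to the following semidefinite program, in the real variables $\eta_{\omega}^k$, $\omega\in\Omega$, $0\le k\le D+1$. Substituting $x_1=t$, $x_2=\nu-t$ in the three integrands gives univariate polynomials $c_\omega,a^{(i,j)}_\omega,b^{(i,j)}_\omega$ in $t$ of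 degree at most $D+1$; for such a polynomial $p=\sum_k p_kt^k$ write $\langle p,\eta_\omega\rangle=\sum_k p_k\eta_\omega^k$. The program is $$\min_\eta\ \sum_\omega\langle c_\omega,\eta_\omega\rangle\quad\text{s.t.}\quad \sum_\omega\langle a^{(i,j)}_\omega,\eta_\omega\rangle\ge 0,\quad \sum_\omega\langle b^{(i,j)}_\omega,\eta_\omega\rangle\ge 0,\quad \eta_\omega^0=1,\quad M_1(\eta_\omega)\succeq 0,\quad M_2(\eta_\omega)\succeq 0,$$ where, if $D+1=2h$, $M_1(m)=(m_{i+j})_{0\le i,j\le h}$ and $M_2(m)=(\nu m_{i+j+1}-m_{i+j+2})_{0\le i,j\le h-1}$, and, if $D+1=2h+1$, $M_1(m)=(m_{i+j+1})_{0\le i,j\le h}$ and $M_2(m)=(\nu m_{i+j}-m_{i+j+1})_{0\le i,j\le h}$. Precisely: (a) a vector $(m_0,\dots,m_{D+1})$ is the vector of moments of orders $0,\dots,D+1$ of a probability measure on $[0,\nu]$ if and only if $m_0=1$, $M_1(m)\succeq0$ and $M_2(m)\succeq 0$. (b) Mapping $\pi_\omega$ to the law $\tilde\pi_\omega$ of $x_1$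 is a bijection from policies onto families of probability measures on $[0,\nu]$, and it turns (GPM) into the problem of minimizing $\sum_\omega\int c_\omega\,d\tilde\pi_\omega$ subject to $\sum_\omega\int a^{(i,j)}_\omega\,d\tilde\pi_\omega\ge 0$ and $\sum_\omega\int b^{(i,j)}_\omega\,d\tilde\pi_\omega\ge 0$, preserving feasibility, infeasibility and cost. (c) The feasible points of the semidefinite program are exactly the moment vectors of the feasible families $\tilde\pi$; a family is feasible if and only if its moment vector is, and the costs agree. (d) Consequently the two problems have the same optimal value (in $[-\infty,+\infty]$), a policy $\pi$ is optimal for (GPM) if and only if the moment vector of $(\tilde\pi_\omega)_\omega$ is optimal for the semidefinite program, and every optimal solution of the semidefinite program is the moment vector of an optimal policy. -/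

import Mathlib

open MeasureTheory Polynomial

noncomputable section

/-! ### The information design problem on parallel links -/

/-- `𝒫_n(r)`: the vectors in `ℝ^n` with nonnegative entries of sum `r`. -/
def flowSimplex (n : ℕ) (r : ℝ) : Set (Fin n → ℝ) :=
  {x | (∀ i, 0 ≤ x i) ∧ ∑ i, x i = r}

/-- A network of `n` parallel links, with finite state space `Ω`, a prior of full support, and
polynomial latencies `ℓ_{ω,i}(f) = ∑_{d ≤ D} α_{d,ω,i} f^d`. -/
structure RoutingGame (Ω : Type*) [Fintype Ω] (n D : ℕ) where
  /-- the prior `μ₀` -/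
  prior : Ω → ℝ
  prior_pos : ∀ ω, 0 < prior ω
  prior_sum : ∑ ω, prior ω = 1
  /-- the coefficients `α_{d,ω,i}` -/
  coeff : Fin (D + 1) → Ω → Fin n → ℝ

/-- A private signaling policy: one probability distribution on `𝒫_n(ν)` for each state. -/
abbrev Policy (Ω : Type*) (n : ℕ) (ν : ℝ) : Type _ :=
  Ω → ProbabilityMeasure (flowSimplex n ν)

namespace RoutingGame

variable {Ω : Type*} [Fintype Ω] {n D : ℕ}

/-- The latency `ℓ_{ω,i}`. -/
def latency (G : RoutingGame Ω n D) (ω : Ω) (i : Fin n) (f : ℝ) : ℝ :=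
  ∑ d : Fin (D + 1), G.coeff d ω i * f ^ (d : ℕ)

/-- Contribution of state `ω` and recommended flow `x` to the expected total latency. -/
def costIntegrand (G : RoutingGame Ω n D) (y : Fin n → ℝ) (ω : Ω) (x : Fin n → ℝ) : ℝ :=
  G.prior ω * ∑ i, (x i + y i) * G.latency ω i (x i + y i)

/-- Contribution of state `ω` and recommended flow `x` to the obedience constraint `(i, j)`:
participants recommended link `i` do not gain by moving to link `j`. -/
def obedienceIntegrand (G : RoutingGame Ω n D) (y : Fin n → ℝ) (i j : Fin n) (ω : Ω)
    (x : Fin n → ℝ) : ℝ :=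
  G.prior ω * ((G.latency ω j (x j + y j) - G.latency ω i (x i + y i)) * x i)

/-- Contribution of state `ω` and recommended flow `x` to the Bayes-Nash constraint `(i, j)`:
non-participants using link `i` do not gain by moving to link `j`. -/
def nashIntegrand (G : RoutingGame Ω n D) (y : Fin n → ℝ) (i j : Fin n) (ω : Ω)
    (x : Fin n → ℝ) : ℝ :=
  G.prior ω * ((G.latency ω j (x j + y j) - G.latency ω i (x i + y i)) * y i)

end RoutingGame

/-! ### The generalized problem of moments -/

/-- Exponents of the monomials in `n` variables of total degree at most `D / 2 + 1`, which is
`(D + 1) / 2` for odd `D` and `D / 2 + 1` for even `D`. -/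
abbrev MonIndex (n D : ℕ) : Type :=
  {a : Fin n → Fin (D / 2 + 2) // ∑ i, (a i : ℕ) ≤ D / 2 + 1}

/-- The vector `z` of all these monomials, evaluated at `x`. -/
def monVec {n : ℕ} (D : ℕ) (x : Fin n → ℝ) : MonIndex n D → ℝ :=
  fun a => ∏ i, x i ^ (a.1 i : ℕ)

/-- Frobenius inner product `M · z zᵀ`, with `z` the monomial vector at `x`. -/
def gramEval {n D : ℕ} (M : Matrix (MonIndex n D) (MonIndex n D) ℝ) (x : Fin n → ℝ) : ℝ :=
  ∑ a, ∑ b, M a b * Matrix.vecMulVec (monVec D x) (monVec D x) a b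

/-- Matrix data of a generalized problem of moments over signaling policies. -/
structure MomentProblem (Ω : Type*) (n D : ℕ) where
  C : Ω → Matrix (MonIndex n D) (MonIndex n D) ℝ
  A : Fin n → Fin n → Ω → Matrix (MonIndex n D) (MonIndex n D) ℝ
  B : Fin n → Fin n → Ω → Matrix (MonIndex n D) (MonIndex n D) ℝ

namespace MomentProblem

variable {Ω : Type*} [Fintype Ω] {n D : ℕ}

/-- `P` is the information design problem of `G` with participation rate `ν` and non-participant
flow `y`: its matrices are symmetric, and on `𝒫_n(ν)` the quadratic forms in `z` are the cost, the
obedience and the Bayes-Nash integrands. -/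
structure Represents (P : MomentProblem Ω n D) (G : RoutingGame Ω n D) (ν : ℝ)
    (y : Fin n → ℝ) : Prop where
  C_symm : ∀ ω, (P.C ω).IsSymm
  A_symm : ∀ i j ω, (P.A i j ω).IsSymm
  B_symm : ∀ i j ω, (P.B i j ω).IsSymm
  cost_eq : ∀ ω, ∀ x ∈ flowSimplex n ν, gramEval (P.C ω) x = G.costIntegrand y ω x
  obedience_eq : ∀ i j ω, ∀ x ∈ flowSimplex n ν,
    gramEval (P.A i j ω) x = G.obedienceIntegrand y i j ω x
  nash_eq : ∀ i j ω, ∀ x ∈ flowSimplex n ν,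
    gramEval (P.B i j ω) x = G.nashIntegrand y i j ω x

/-- The objective `∑_ω ∫ C_ω · z zᵀ dπ_ω`. -/
def cost (P : MomentProblem Ω n D) {ν : ℝ} (π : Policy Ω n ν) : ℝ :=
  ∑ ω, ∫ x, gramEval (P.C ω) x.1 ∂(π ω : Measure (flowSimplex n ν))

/-- The policies that satisfy the obedience and the Bayes-Nash constraints. -/
def feasibleSet (P : MomentProblem Ω n D) (ν : ℝ) : Set (Policy Ω n ν) :=
  {π | (∀ i j, 0 ≤ ∑ ω, ∫ x, gramEval (P.A i j ω) x.1 ∂(π ω : Measure (flowSimplex n ν))) ∧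
    (∀ i j, 0 ≤ ∑ ω, ∫ x, gramEval (P.B i j ω) x.1 ∂(π ω : Measure (flowSimplex n ν)))}

end MomentProblem

/-! ### Optimal values and solutions of minimization problems -/

/-- Optimal value of `min f` over `S` (`⊤` if `S` is empty). -/
def optValue {X : Type*} (f : X → ℝ) (S : Set X) : EReal :=
  ⨅ x ∈ S, (f x : EReal)

/-- `x` is an optimal solution of `min f` over `S`. -/
def IsOptimal {X : Type*} (f : X → ℝ) (S : Set X) (x : X) : Prop :=
  x ∈ S ∧ ∀ x' ∈ S, f x ≤ f x'

/-! ### Semidefinite programs -/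

/-- Data of a semidefinite program in the real variables `v : V`: a linear objective, finitely many
linear equations and inequalities, and linear matrix inequalities
`∑_v x_v • lmiCoeff b v ≽ lmiRhs b` between real symmetric matrices. -/
structure SDP (V E I B : Type*) where
  obj : V → ℝ
  eqCoeff : E → V → ℝ
  eqRhs : E → ℝ
  ineqCoeff : I → V → ℝ
  ineqRhs : I → ℝ
  size : B → ℕ
  lmiCoeff : (b : B) → V → Matrix (Fin (size b)) (Fin (size b)) ℝ
  lmiRhs : (b : B) → Matrix (Fin (size b)) (Fin (size b)) ℝ
  lmiCoeff_symm : ∀ b v, (lmiCoeff b v).IsSymm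
  lmiRhs_symm : ∀ b, (lmiRhs b).IsSymm

namespace SDP

variable {V E I B : Type*} [Fintype V]

/-- The objective function. -/
def objective (S : SDP V E I B) (x : V → ℝ) : ℝ :=
  ∑ v, S.obj v * x v

/-- The feasible set. -/
def feasibleSet (S : SDP V E I B) : Set (V → ℝ) :=
  {x | (∀ e, ∑ v, S.eqCoeff e v * x v = S.eqRhs e) ∧
    (∀ i, S.ineqRhs i ≤ ∑ v, S.ineqCoeff i v * x v) ∧
    (∀ b, (∑ v, x v • S.lmiCoeff b v - S.lmiRhs b).PosSemidef)}

end SDP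

/-! ### Two links: univariate measures on `[0, ν]` -/

/-- The flow on the first link; it determines the recommended flow vector. -/
def firstFlow (ν : ℝ) (x : flowSimplex 2 ν) : Set.Icc (0 : ℝ) ν :=
  ⟨x.1 0, x.2.1 0, by
    have h := x.2.2
    have h1 := x.2.1 1
    rw [Fin.sum_univ_two] at h
    linarith⟩

theorem measurable_firstFlow (ν : ℝ) : Measurable (firstFlow ν) :=
  Measurable.subtype_mk ((measurable_pi_apply 0).comp measurable_subtype_coe)

/-- The laws of the flow on the first link under a policy, one for each state. -/
def firstLinkLaw {Ω : Type*} {ν : ℝ} (π : Policy Ω 2 ν) :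
    Ω → ProbabilityMeasure (Set.Icc (0 : ℝ) ν) :=
  fun ω => (π ω).map (measurable_firstFlow ν).aemeasurable

/-- The moments of orders `0, …, d` of a probability measure on `[0, ν]`. -/
def truncatedMoments {ν : ℝ} (d : ℕ) (ρ : ProbabilityMeasure (Set.Icc (0 : ℝ) ν)) :
    Fin (d + 1) → ℝ :=
  fun k => ∫ t, (t : ℝ) ^ (k : ℕ) ∂(ρ : Measure (Set.Icc (0 : ℝ) ν))

namespace RoutingGame

variable {Ω : Type*} [Fintype Ω] {D : ℕ}

/-- The recommended flow on each link, as a polynomial in the flow on the first link. -/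
def recFlowPoly (ν : ℝ) : Fin 2 → ℝ[X] :=
  ![X, C ν - X]

/-- The latency on link `i` in state `ω`, as a polynomial in the recommended flow on the first
link. -/
def latencyPoly (G : RoutingGame Ω 2 D) (ν : ℝ) (y : Fin 2 → ℝ) (ω : Ω) (i : Fin 2) : ℝ[X] :=
  ∑ d : Fin (D + 1), C (G.coeff d ω i) * (recFlowPoly ν i + C (y i)) ^ (d : ℕ)

/-- The cost integrand as a polynomial in the recommended flow on the first link. -/
def costPoly (G : RoutingGame Ω 2 D) (ν : ℝ) (y : Fin 2 → ℝ) (ω : Ω) : ℝ[X] :=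
  C (G.prior ω) * ∑ i, (recFlowPoly ν i + C (y i)) * G.latencyPoly ν y ω i

/-- The obedience integrand as a polynomial in the recommended flow on the first link. -/
def obediencePoly (G : RoutingGame Ω 2 D) (ν : ℝ) (y : Fin 2 → ℝ) (i j : Fin 2) (ω : Ω) : ℝ[X] :=
  C (G.prior ω) * ((G.latencyPoly ν y ω j - G.latencyPoly ν y ω i) * recFlowPoly ν i)

/-- The Bayes-Nash integrand as a polynomial in the recommended flow on the first link. -/
def nashPoly (G : RoutingGame Ω 2 D) (ν : ℝ) (y : Fin 2 → ℝ) (i j : Fin 2) (ω : Ω) : ℝ[X] :=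
  C (G.prior ω) * ((G.latencyPoly ν y ω j - G.latencyPoly ν y ω i) * C (y i))

/-- The objective of the univariate problem. -/
def uniCost (G : RoutingGame Ω 2 D) (ν : ℝ) (y : Fin 2 → ℝ)
    (ρ : Ω → ProbabilityMeasure (Set.Icc (0 : ℝ) ν)) : ℝ :=
  ∑ ω, ∫ t, (G.costPoly ν y ω).eval (t : ℝ) ∂(ρ ω : Measure (Set.Icc (0 : ℝ) ν))

/-- The feasible set of the univariate problem. -/
def uniFeasibleSet (G : RoutingGame Ω 2 D) (ν : ℝ) (y : Fin 2 → ℝ) :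
    Set (Ω → ProbabilityMeasure (Set.Icc (0 : ℝ) ν)) :=
  {ρ | (∀ i j, 0 ≤ ∑ ω, ∫ t, (G.obediencePoly ν y i j ω).eval (t : ℝ)
        ∂(ρ ω : Measure (Set.Icc (0 : ℝ) ν))) ∧
    (∀ i j, 0 ≤ ∑ ω, ∫ t, (G.nashPoly ν y i j ω).eval (t : ℝ)
        ∂(ρ ω : Measure (Set.Icc (0 : ℝ) ν)))}

end RoutingGame

/-! ### Hankel and localizing matrices, and the semidefinite program -/

/-- The coefficient matrix of the `k`-th moment in the `N × N` localizing matrix with weight `w`: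
its entry at `(i, j)` is the coefficient of `t^k` in `w(t) t^(i+j)`. -/
def localizingCoeff (w : ℝ[X]) (N k : ℕ) : Matrix (Fin N) (Fin N) ℝ :=
  Matrix.of fun i j => (w * X ^ ((i : ℕ) + (j : ℕ))).coeff k

theorem localizingCoeff_isSymm (w : ℝ[X]) (N k : ℕ) : (localizingCoeff w N k).IsSymm := by
  ext i j
  simp [localizingCoeff, Nat.add_comm]

/-- The weights of the two localizing matrices for moments of orders `0, …, d` on `[0, ν]`:
`1` and `t (ν - t)` if `d` is even, `t` and `ν - t` if `d` is odd. -/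
def locWeight (ν : ℝ) (d : ℕ) : Fin 2 → ℝ[X] :=
  if Even d then ![1, X * (C ν - X)] else ![X, C ν - X]

/-- The sizes of the two localizing matrices. -/
def locSize (d : ℕ) : Fin 2 → ℕ :=
  ![d / 2 + 1, (d + 1) / 2]

/-- The two localizing matrices of a real sequence `m_0, …, m_d`. For even `d = 2h` these are
`(m_{i+j})_{0≤i,j≤h}` and `(ν m_{i+j+1} - m_{i+j+2})_{0≤i,j≤h-1}`; for odd `d = 2h+1` they are
`(m_{i+j+1})_{0≤i,j≤h}` and `(ν m_{i+j} - m_{i+j+1})_{0≤i,j≤h}`. -/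
def localizingMatrix (ν : ℝ) {d : ℕ} (m : Fin (d + 1) → ℝ) (b : Fin 2) :
    Matrix (Fin (locSize d b)) (Fin (locSize d b)) ℝ :=
  ∑ k : Fin (d + 1), m k • localizingCoeff (locWeight ν d b) (locSize d b) k

/-- The semidefinite program. Its variables `η_{ω,k}` stand for the moments of orders
`0, …, D + 1` of the flow on the first link in each state `ω`. -/
def momentSDP {Ω : Type*} [Fintype Ω] [DecidableEq Ω] {D : ℕ} (G : RoutingGame Ω 2 D) (ν : ℝ)
    (y : Fin 2 → ℝ) :
    SDP (Ω × Fin (D + 1 + 1)) Ω ((Fin 2 × Fin 2) ⊕ (Fin 2 × Fin 2)) (Ω × Fin 2) where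
  obj v := (G.costPoly ν y v.1).coeff v.2
  eqCoeff ω v := if v = (ω, 0) then 1 else 0
  eqRhs _ := 1
  ineqCoeff c v := Sum.elim
    (fun p => (G.obediencePoly ν y p.1 p.2 v.1).coeff v.2)
    (fun p => (G.nashPoly ν y p.1 p.2 v.1).coeff v.2) c
  ineqRhs _ := 0
  size b := locSize (D + 1) b.2
  lmiCoeff b v :=
    if v.1 = b.1 then localizingCoeff (locWeight ν (D + 1) b.2) (locSize (D + 1) b.2) v.2 else 0
  lmiRhs _ := 0
  lmiCoeff_symm b v := by
    split_ifs
    · exact localizingCoeff_isSymm _ _ _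
    · exact Matrix.isSymm_zero
  lmiRhs_symm _ := Matrix.isSymm_zero

/-- The vector of all moments of orders `0, …, D + 1` of a family of univariate measures. -/
def momentVector {Ω : Type*} {ν : ℝ} (D : ℕ) (ρ : Ω → ProbabilityMeasure (Set.Icc (0 : ℝ) ν)) :
    Ω × Fin (D + 1 + 1) → ℝ :=
  fun v => truncatedMoments (D + 1) (ρ v.1) v.2

end

/-! On two links the recommended flow lies on a segment, so a policy amounts to a family of laws of
`x_1` on `[0, ν]`, and every integrand is a polynomial of degree at most `D + 1` in `x_1`. Cost and
constraints therefore depend on a policy only through the moments of orders `0, …, D + 1`, and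
linearly so. The substance is the description of the moment vectors,
`exists_truncatedMoments_eq_iff`.

Let `L` be the functional `t^k ↦ m_k`. The quadratic form of the localizing matrix of weight `w`, at
the coefficient vector of `q`, is `L (w q²)`. For moments of a measure this is the integral of a
nonnegative function. Conversely, semidefiniteness makes `L` nonnegative on the cone of weighted
squares. For `ν > 0` this cone contains every polynomial of degree at most `d` that is nonnegative
on `[0, ν]` (`mem_weightedSquares_of_nonneg`). Since the set of moment vectors is compact and
convex, a vector outside it would be cut off by a hyperplane, that is, by a polynomial positive on
`[0, ν]` on which `L` is negative (`mem_range_truncatedMoments`). For `ν = 0` the cone is in general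
too small, but the matrix inequalities force all moments of positive order to vanish.

The moment map need not be injective on measures. It maps the feasible set onto the feasible set and
preserves and reflects feasibility and cost, which suffices to transfer values and optimal
solutions. -/

/-! ### Nonnegative polynomials on a compact interval -/

/-- The cone of the polynomials of degree at most `d` generated by the products of a weight of the
localizing matrices and a square. -/
noncomputable def weightedSquares (ν : ℝ) (d : ℕ) : AddSubmonoid ℝ[X] :=
  AddSubmonoid.closure
    {p | ∃ b, ∃ q : ℝ[X], q.degree < (locSize d b : ℕ) ∧ p = locWeight ν d b * q ^ 2}

theorem weight_mul_sq_mem_weightedSquares {ν : ℝ} {d : ℕ} (b : Fin 2) {q : ℝ[X]}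
    (hq : q.degree < (locSize d b : ℕ)) : locWeight ν d b * q ^ 2 ∈ weightedSquares ν d :=
  AddSubmonoid.subset_closure ⟨b, q, hq, rfl⟩

/-- Multiplication by `f` is additive, so generators suffice. -/
theorem mul_mem_weightedSquares {ν : ℝ} {d e : ℕ} {f p : ℝ[X]} (hp : p ∈ weightedSquares ν d)
    (h : ∀ b, ∀ q : ℝ[X], q.degree < (locSize d b : ℕ) →
      f * (locWeight ν d b * q ^ 2) ∈ weightedSquares ν e) : f * p ∈ weightedSquares ν e := by
  induction hp using AddSubmonoid.closure_induction with
  | mem p hp => obtain ⟨b, q, hq, rfl⟩ := hp; exact h b q hq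
  | zero => simp
  | add p q _ _ hp hq => rw [mul_add]; exact add_mem hp hq

theorem degree_mul_lt_of_natDegree_le_one {f q : ℝ[X]} {m n : ℕ} (hf : f.natDegree ≤ 1)
    (hq : q.degree < (m : ℕ)) (h : m + 1 ≤ n) : (f * q).degree < (n : ℕ) := by
  rw [degree_lt_iff_coeff_zero] at hq ⊢
  intro k hk
  rcases Nat.eq_zero_or_pos m with rfl | hm
  -- Blocks of size zero do occur: the second one is empty when `d = 0`.
  · have : q = 0 := by ext i; simpa using hq i (Nat.zero_le _)
    simp [this]
  · have h2 : q.natDegree ≤ m - 1 :=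
      natDegree_le_iff_coeff_eq_zero.2 fun i hi => hq i (by omega)
    exact coeff_eq_zero_of_natDegree_lt
      ((natDegree_mul_le.trans (Nat.add_le_add hf h2)).trans_lt (by omega))

theorem degree_lt_of_le_natCast {q : ℝ[X]} {m n : ℕ} (hq : q.degree < (m : ℕ)) (h : m ≤ n) :
    q.degree < (n : ℕ) :=
  hq.trans_le (by exact_mod_cast h)

theorem natDegree_C_sub_X_le (ν : ℝ) : (C ν - X : ℝ[X]).natDegree ≤ 1 :=
  (natDegree_sub_le _ _).trans (by simp)

/-- A factor `t` exchanges the two kinds of weights up to squares: `1` becomes `t`, `t (ν - t)`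
becomes `(ν - t) t²`, `t` becomes `1 · t²`, and `ν - t` becomes `t (ν - t)`. -/
theorem X_mul_mem_weightedSquares {ν : ℝ} {d : ℕ} {p : ℝ[X]} (hp : p ∈ weightedSquares ν d) :
    X * p ∈ weightedSquares ν (d + 1) := by
  refine mul_mem_weightedSquares hp fun b q hq => ?_
  by_cases hd : Even d
  · have hd' : ¬ Even (d + 1) := by simpa [Nat.even_add_one] using hd
    have hd2 := Nat.even_iff.1 hd
    fin_cases b
    · have := weight_mul_sq_mem_weightedSquares (ν := ν) (d := d + 1) 0 (q := q)
        (degree_lt_of_le_natCast hq (by simp [locSize]; omega))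
      convert this using 1
      simp [locWeight, hd, hd']
    · have := weight_mul_sq_mem_weightedSquares (ν := ν) (d := d + 1) 1 (q := X * q)
        (degree_mul_lt_of_natDegree_le_one natDegree_X_le hq (by simp [locSize]; omega))
      convert this using 1
      simp [locWeight, hd, hd']
      ring
  · have hd' : Even (d + 1) := by simpa [Nat.even_add_one] using hd
    have hd2 := Nat.odd_iff.1 (Nat.not_even_iff_odd.1 hd)
    fin_cases b
    · have := weight_mul_sq_mem_weightedSquares (ν := ν) (d := d + 1) 0 (q := X * q)
        (degree_mul_lt_of_natDegree_le_one natDegree_X_le hq (by simp [locSize]; omega))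
      convert this using 1
      simp [locWeight, hd, hd']
      ring
    · have := weight_mul_sq_mem_weightedSquares (ν := ν) (d := d + 1) 1 (q := q)
        (degree_lt_of_le_natCast hq (by simp [locSize]; omega))
      convert this using 1
      simp [locWeight, hd, hd']
      ring

theorem C_sub_X_mul_mem_weightedSquares {ν : ℝ} {d : ℕ} {p : ℝ[X]}
    (hp : p ∈ weightedSquares ν d) : (C ν - X) * p ∈ weightedSquares ν (d + 1) := by
  refine mul_mem_weightedSquares hp fun b q hq => ?_
  by_cases hd : Even d
  · have hd' : ¬ Even (d + 1) := by simpa [Nat.even_add_one] using hd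
    have hd2 := Nat.even_iff.1 hd
    fin_cases b
    · have := weight_mul_sq_mem_weightedSquares (ν := ν) (d := d + 1) 1 (q := q)
        (degree_lt_of_le_natCast hq (by simp [locSize]; omega))
      convert this using 1
      simp [locWeight, hd, hd']
    · have := weight_mul_sq_mem_weightedSquares (ν := ν) (d := d + 1) 0 (q := (C ν - X) * q)
        (degree_mul_lt_of_natDegree_le_one (natDegree_C_sub_X_le ν) hq (by simp [locSize]))
      convert this using 1
      simp [locWeight, hd, hd']
      ring
  · have hd' : Even (d + 1) := by simpa [Nat.even_add_one] using hd
    have hd2 := Nat.odd_iff.1 (Nat.not_even_iff_odd.1 hd)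
    fin_cases b
    · have := weight_mul_sq_mem_weightedSquares (ν := ν) (d := d + 1) 1 (q := q)
        (degree_lt_of_le_natCast hq (by simp [locSize]; omega))
      convert this using 1
      simp [locWeight, hd, hd']
      ring
    · have := weight_mul_sq_mem_weightedSquares (ν := ν) (d := d + 1) 0 (q := (C ν - X) * q)
        (degree_mul_lt_of_natDegree_le_one (natDegree_C_sub_X_le ν) hq (by simp [locSize]))
      convert this using 1
      simp [locWeight, hd, hd']
      ring

/-- The parity of the degree, hence the weight, is unchanged; `t - r` is absorbed into `q`, and both
sizes grow by one. -/
theorem sq_mul_mem_weightedSquares {ν : ℝ} {d : ℕ} {p : ℝ[X]} (r : ℝ)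
    (hp : p ∈ weightedSquares ν d) : (X - C r) ^ 2 * p ∈ weightedSquares ν (d + 2) := by
  refine mul_mem_weightedSquares hp fun b q hq => ?_
  have h := weight_mul_sq_mem_weightedSquares (ν := ν) (d := d + 2) b (q := (X - C r) * q)
    (degree_mul_lt_of_natDegree_le_one (by simp) hq (by
      fin_cases b
      · simp [locSize]
      · simp [locSize]; omega))
  convert h using 1
  have h2 : locWeight ν (d + 2) = locWeight ν d := by simp [locWeight, Nat.even_add]
  rw [h2]
  ring

/-- For odd `d` no weight is constant, and `c = (c / ν) t + (c / ν) (ν - t)` is used instead; this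
needs `ν > 0`. -/
theorem C_mem_weightedSquares {ν : ℝ} (hν : 0 < ν) (d : ℕ) {c : ℝ} (hc : 0 ≤ c) :
    C c ∈ weightedSquares ν d := by
  have hdeg (a : ℝ) (n : ℕ) (hn : 0 < n) : (C a).degree < (n : ℕ) :=
    degree_C_le.trans_lt (by exact_mod_cast hn)
  by_cases hd : Even d
  · have h := weight_mul_sq_mem_weightedSquares (ν := ν) (d := d) 0 (q := C √c)
      (hdeg _ _ (by simp [locSize]))
    simpa [locWeight, hd, ← C_pow, Real.sq_sqrt hc] using h
  · have hd2 := Nat.odd_iff.1 (Nat.not_even_iff_odd.1 hd)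
    have h := add_mem
      (weight_mul_sq_mem_weightedSquares (ν := ν) (d := d) 0 (q := C √(c / ν))
        (hdeg _ _ (by simp [locSize])))
      (weight_mul_sq_mem_weightedSquares (ν := ν) (d := d) 1 (q := C √(c / ν))
        (hdeg _ _ (by simp [locSize]; omega)))
    have h2 : C c = C ν * C (c / ν) := by rw [← C_mul, mul_div_cancel₀ _ hν.ne']
    convert h using 1
    simp only [locWeight, hd, ← C_pow, Real.sq_sqrt (div_nonneg hc hν.le), h2]
    simp
    ring

/-- Since `ν > 0`, the point `r` is a one-sided limit of other points of the interval. This recovers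
the sign of a cofactor at the root that was divided out. -/
theorem eval_nonneg_of_nonneg_of_ne {ν r : ℝ} (hν : 0 < ν) (hr : r ∈ Set.Icc 0 ν) {q : ℝ[X]}
    (h : ∀ t ∈ Set.Icc 0 ν, t ≠ r → 0 ≤ q.eval t) : ∀ t ∈ Set.Icc 0 ν, 0 ≤ q.eval t := by
  intro t ht
  rcases eq_or_ne t r with rfl | hne
  · rcases lt_or_ge t ν with htν | htν
    · refine ge_of_tendsto (q.continuous.continuousWithinAt (s := Set.Ioi t) (x := t)) ?_
      filter_upwards [Ioo_mem_nhdsGT htν] with s hs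
      exact h s ⟨hr.1.trans hs.1.le, hs.2.le⟩ hs.1.ne'
    · refine ge_of_tendsto (q.continuous.continuousWithinAt (s := Set.Iio t) (x := t)) ?_
      filter_upwards [Ioo_mem_nhdsLT (hν.trans_le htν)] with s hs
      exact h s ⟨hs.1.le, hs.2.le.trans hr.2⟩ hs.2.ne
  · exact h t ht hne

/-- The **Markov-Lukács theorem**: a polynomial of degree at most `d` that is nonnegative on
`[0, ν]` is a combination of weighted squares. -/
theorem mem_weightedSquares_of_nonneg {ν : ℝ} (hν : 0 < ν) :
    ∀ (d : ℕ) (p : ℝ[X]), p.natDegree ≤ d → (∀ t ∈ Set.Icc 0 ν, 0 ≤ p.eval t) →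
      p ∈ weightedSquares ν d := by
  intro d
  induction d using Nat.strong_induction_on with
  | _ d ih =>
    intro p hpd hp
    obtain ⟨r, hr, hmin⟩ := isCompact_Icc.exists_isMinOn (Set.nonempty_Icc.2 hν.le)
      (p.continuous.continuousOn (s := Set.Icc 0 ν))
    -- Subtracting the minimum, a nonnegative constant in the cone, creates a root at the minimizer
    -- `r`. Dividing it out lowers the degree.
    suffices H : ∀ g : ℝ[X], g.natDegree ≤ d → (∀ t ∈ Set.Icc 0 ν, 0 ≤ g.eval t) →
        g.IsRoot r → g ∈ weightedSquares ν d by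
      have h1 := H (p - C (p.eval r)) (natDegree_sub_C.trans_le hpd)
        (fun t ht => by simpa using hmin ht) (by simp)
      have h2 := add_mem h1 (C_mem_weightedSquares hν d (hp r hr))
      rwa [sub_add_cancel] at h2
    intro g hgd hg hroot
    rcases eq_or_ne g 0 with rfl | hg0
    · exact zero_mem _
    obtain ⟨q, rfl⟩ := dvd_iff_isRoot.2 hroot
    have hq0 : q ≠ 0 := right_ne_zero_of_mul hg0
    rw [natDegree_mul (X_sub_C_ne_zero r) hq0, natDegree_X_sub_C] at hgd
    rcases hr.1.eq_or_lt with rfl | hr0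
    · obtain ⟨e, rfl⟩ : ∃ e, d = e + 1 := ⟨d - 1, by omega⟩
      rw [C_0, sub_zero]
      refine X_mul_mem_weightedSquares (ih e (by omega) q (by omega)
        (eval_nonneg_of_nonneg_of_ne hν hr fun t ht hne => ?_))
      have h1 := hg t ht
      simp only [C_0, sub_zero, eval_mul, eval_X] at h1
      exact nonneg_of_mul_nonneg_right h1 (ht.1.lt_of_ne' hne)
    rcases hr.2.eq_or_lt with rfl | hrν
    · obtain ⟨e, rfl⟩ : ∃ e, d = e + 1 := ⟨d - 1, by omega⟩
      -- On the interval `t - ν` is nonpositive, so both factors change sign.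
      rw [← neg_mul_neg, neg_sub]
      refine C_sub_X_mul_mem_weightedSquares (ih e (by omega) (-q) (by rw [natDegree_neg]; omega)
        (eval_nonneg_of_nonneg_of_ne hν hr fun t ht hne => ?_))
      have h1 := hg t ht
      rw [← neg_mul_neg, neg_sub] at h1
      rw [eval_mul] at h1
      refine nonneg_of_mul_nonneg_right h1 ?_
      simpa using ht.2.lt_of_ne hne
    -- An interior root is double: `q` is nonpositive to the left of `r` and nonnegative to the
    -- right.
    have hq : q.IsRoot r := by
      refine le_antisymm ?_ ?_
      · refine le_of_tendsto (q.continuous.continuousWithinAt (s := Set.Iio r) (x := r)) ?_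
        filter_upwards [Ioo_mem_nhdsLT hr0] with s hs
        have h1 := hg s ⟨hs.1.le, hs.2.le.trans hr.2⟩
        simp only [eval_mul, eval_sub, eval_X, eval_C] at h1
        nlinarith [hs.2]
      · refine ge_of_tendsto (q.continuous.continuousWithinAt (s := Set.Ioi r) (x := r)) ?_
        filter_upwards [Ioo_mem_nhdsGT hrν] with s hs
        have h1 := hg s ⟨hr.1.trans hs.1.le, hs.2.le⟩
        simp only [eval_mul, eval_sub, eval_X, eval_C] at h1
        exact nonneg_of_mul_nonneg_right h1 (sub_pos.2 hs.1)
    obtain ⟨f, rfl⟩ := dvd_iff_isRoot.2 hq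
    rw [natDegree_mul (X_sub_C_ne_zero r) (right_ne_zero_of_mul hq0), natDegree_X_sub_C] at hgd
    obtain ⟨e, rfl⟩ : ∃ e, d = e + 2 := ⟨d - 2, by omega⟩
    rw [← mul_assoc, ← sq] at hg ⊢
    refine sq_mul_mem_weightedSquares r (ih e (by omega) f (by omega)
      (eval_nonneg_of_nonneg_of_ne hν hr fun t ht hne => ?_))
    have h1 := hg t ht
    rw [eval_mul] at h1
    refine nonneg_of_mul_nonneg_right h1 ?_
    have := sub_ne_zero.2 hne
    simp only [eval_pow, eval_sub, eval_X, eval_C]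
    positivity

/-! ### The truncated Hausdorff moment problem -/

/-- The linear functional on polynomials with moments `m` of orders `0, …, d`, which vanishes on
the monomials of higher degree. -/
noncomputable def momentFunctional {d : ℕ} (m : Fin (d + 1) → ℝ) : ℝ[X] →ₗ[ℝ] ℝ :=
  ∑ k : Fin (d + 1), m k • lcoeff ℝ (k : ℕ)

theorem momentFunctional_apply {d : ℕ} (m : Fin (d + 1) → ℝ) (p : ℝ[X]) :
    momentFunctional m p = ∑ k : Fin (d + 1), m k * p.coeff k := by
  simp [momentFunctional]

theorem momentFunctional_X_pow {d : ℕ} (m : Fin (d + 1) → ℝ) (k : Fin (d + 1)) :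
    momentFunctional m (X ^ (k : ℕ)) = m k := by
  simp [momentFunctional_apply, coeff_X_pow, ← Fin.ext_iff]

theorem localizingMatrix_apply (ν : ℝ) {d : ℕ} (m : Fin (d + 1) → ℝ) (b : Fin 2)
    (i j : Fin (locSize d b)) :
    localizingMatrix ν m b i j =
      momentFunctional m (locWeight ν d b * X ^ ((i : ℕ) + (j : ℕ))) := by
  simp [localizingMatrix, momentFunctional_apply, Matrix.sum_apply, localizingCoeff]

/-- The entry at `(i, j)` depends only on `i + j`, so the quadratic form is the expansion of a
square. This links semidefiniteness to the cone of weighted squares. -/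
theorem dotProduct_localizingMatrix_mulVec (ν : ℝ) {d : ℕ} (m : Fin (d + 1) → ℝ) (b : Fin 2)
    (v : Fin (locSize d b) → ℝ) :
    star v ⬝ᵥ (localizingMatrix ν m b).mulVec v =
      momentFunctional m (locWeight ν d b * (∑ i, v i • X ^ (i : ℕ)) ^ 2) := by
  rw [sq, Finset.sum_mul_sum]
  simp only [Finset.mul_sum, map_sum, dotProduct, Matrix.mulVec,
    localizingMatrix_apply, star_trivial]
  refine Finset.sum_congr rfl fun i _ => Finset.sum_congr rfl fun j _ => ?_
  rw [smul_mul_smul_comm, ← pow_add, mul_smul_comm, map_smul, smul_eq_mul]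
  ring

theorem isHermitian_localizingMatrix (ν : ℝ) {d : ℕ} (m : Fin (d + 1) → ℝ) (b : Fin 2) :
    (localizingMatrix ν m b).IsHermitian := by
  ext i j
  simp [localizingMatrix_apply, add_comm]

theorem momentFunctional_weight_mul_sq_nonneg {ν : ℝ} {d : ℕ} {m : Fin (d + 1) → ℝ} {b : Fin 2}
    (h : (localizingMatrix ν m b).PosSemidef) {q : ℝ[X]} (hq : q.degree < (locSize d b : ℕ)) :
    0 ≤ momentFunctional m (locWeight ν d b * q ^ 2) := by
  have h1 := h.dotProduct_mulVec_nonneg fun i => q.coeff i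
  have h2 : ∑ i : Fin (locSize d b), q.coeff i • (X : ℝ[X]) ^ (i : ℕ) = q := by
    rw [sum_fin (fun i a => a • (X : ℝ[X]) ^ i) (by simp) hq]
    conv_rhs => rw [q.as_sum_support_C_mul_X_pow]
    simp [Polynomial.sum, smul_eq_C_mul]
  rwa [dotProduct_localizingMatrix_mulVec, h2] at h1

theorem momentFunctional_nonneg_of_mem_weightedSquares {ν : ℝ} {d : ℕ} {m : Fin (d + 1) → ℝ}
    (h : ∀ b, (localizingMatrix ν m b).PosSemidef) {p : ℝ[X]} (hp : p ∈ weightedSquares ν d) :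
    0 ≤ momentFunctional m p := by
  induction hp using AddSubmonoid.closure_induction with
  | mem p hp => obtain ⟨b, q, hq, rfl⟩ := hp; exact momentFunctional_weight_mul_sq_nonneg (h b) hq
  | zero => simp
  | add p q _ _ hp hq => rw [map_add]; exact add_nonneg hp hq

theorem integrable_eval {ν : ℝ} (ρ : ProbabilityMeasure (Set.Icc (0 : ℝ) ν)) (p : ℝ[X]) :
    Integrable (fun t : Set.Icc (0 : ℝ) ν => p.eval (t : ℝ))
      (ρ : Measure (Set.Icc (0 : ℝ) ν)) := by
  have h := (p.continuous.comp continuous_subtype_val).continuousOn.integrableOn_compact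
    (μ := (ρ : Measure (Set.Icc (0 : ℝ) ν))) (isCompact_univ (X := Set.Icc (0 : ℝ) ν))
  rwa [integrableOn_univ] at h

/-- The degree bound ensures that the functional discards no coefficient of `p`. -/
theorem integral_eval_eq_momentFunctional {ν : ℝ} {d : ℕ}
    (ρ : ProbabilityMeasure (Set.Icc (0 : ℝ) ν)) {p : ℝ[X]} (hp : p.natDegree ≤ d) :
    ∫ t, p.eval (t : ℝ) ∂(ρ : Measure (Set.Icc (0 : ℝ) ν)) =
      momentFunctional (truncatedMoments d ρ) p := by
  simp only [eval_eq_sum_range' (Nat.lt_succ_of_le hp)]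
  rw [integral_finsetSum, momentFunctional_apply, Finset.sum_range]
  · refine Finset.sum_congr rfl fun k _ => ?_
    rw [integral_const_mul, mul_comm]
    rfl
  · intro k _
    simpa using (integrable_eval ρ (X ^ k)).const_mul (p.coeff k)

theorem eval_locWeight_nonneg {ν : ℝ} (d : ℕ) (b : Fin 2) {t : ℝ} (ht : t ∈ Set.Icc 0 ν) :
    0 ≤ (locWeight ν d b).eval t := by
  have h1 := ht.1
  have h2 := sub_nonneg.2 ht.2
  by_cases hd : Even d <;> fin_cases b <;> simp [locWeight, hd] <;> first | positivity | linarith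

/-- For a nonempty block of size `N`, the degree of the weight plus `2 (N - 1)` is at most `d`. -/
theorem natDegree_locWeight_mul_sq_le {ν : ℝ} {d : ℕ} (b : Fin 2) {q : ℝ[X]}
    (hq : q.degree < (locSize d b : ℕ)) : (locWeight ν d b * q ^ 2).natDegree ≤ d := by
  rcases eq_or_ne q 0 with rfl | hq0
  · simp
  have h1 : q.natDegree < locSize d b := (natDegree_lt_iff_degree_lt hq0).2 hq
  have h2 : (locWeight ν d b).natDegree + 2 * (locSize d b - 1) ≤ d := by
    have hX : (X : ℝ[X]).natDegree ≤ 1 := natDegree_X_le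
    have hC := natDegree_C_sub_X_le ν
    have hXC : (X * (C ν - X)).natDegree ≤ 2 :=
      natDegree_mul_le.trans (Nat.add_le_add hX hC)
    by_cases hd : Even d
    · have hd2 := Nat.even_iff.1 hd
      fin_cases b <;> simp [locWeight, hd, locSize] at h1 ⊢ <;> omega
    · have hd2 := Nat.odd_iff.1 (Nat.not_even_iff_odd.1 hd)
      fin_cases b <;> simp [locWeight, hd, locSize] at h1 hC ⊢ <;> omega
  refine natDegree_mul_le.trans (le_trans (Nat.add_le_add_left ?_ _) h2)
  rw [natDegree_pow]
  omega

theorem posSemidef_localizingMatrix {ν : ℝ} {d : ℕ}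
    (ρ : ProbabilityMeasure (Set.Icc (0 : ℝ) ν)) (b : Fin 2) :
    (localizingMatrix ν (truncatedMoments d ρ) b).PosSemidef := by
  refine .of_dotProduct_mulVec_nonneg (isHermitian_localizingMatrix _ _ _) fun v => ?_
  rw [dotProduct_localizingMatrix_mulVec, ← integral_eval_eq_momentFunctional]
  · refine integral_nonneg fun t => ?_
    simp only [eval_mul, eval_pow]
    exact mul_nonneg (eval_locWeight_nonneg d b t.2) (sq_nonneg _)
  · refine natDegree_locWeight_mul_sq_le b ?_
    rw [degree_lt_iff_coeff_zero]
    intro k hk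
    simp only [finsetSum_coeff, coeff_smul, coeff_X_pow]
    refine Finset.sum_eq_zero fun i _ => ?_
    have := i.2
    rw [if_neg (by omega), smul_zero]

theorem truncatedMoments_zero {ν : ℝ} (d : ℕ) (ρ : ProbabilityMeasure (Set.Icc (0 : ℝ) ν)) :
    truncatedMoments d ρ 0 = 1 := by
  simp [truncatedMoments]

/-- Monomials are bounded and continuous on `[0, ν]`, so weak convergence controls them. As the
probability measures on a compact space form a compact space, the set of moment vectors is compact.
-/
theorem continuous_truncatedMoments (ν : ℝ) (d : ℕ) :
    Continuous (truncatedMoments (ν := ν) d) := by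
  refine continuous_pi fun k => ?_
  exact ProbabilityMeasure.continuous_integral_boundedContinuousFunction
    (BoundedContinuousFunction.mkOfCompact
      ⟨fun t : Set.Icc (0 : ℝ) ν => (t : ℝ) ^ (k : ℕ), by fun_prop⟩)

theorem convex_range_truncatedMoments (ν : ℝ) (d : ℕ) :
    Convex ℝ (Set.range (truncatedMoments (ν := ν) d)) := by
  rintro _ ⟨ρ, rfl⟩ _ ⟨σ, rfl⟩ a b ha hb hab
  have hp : IsProbabilityMeasure (ENNReal.ofReal a • (ρ : Measure (Set.Icc (0 : ℝ) ν)) +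
      ENNReal.ofReal b • (σ : Measure (Set.Icc (0 : ℝ) ν))) := by
    constructor
    simp [← ENNReal.ofReal_add ha hb, hab]
  refine ⟨⟨_, hp⟩, ?_⟩
  ext k
  have hρ := integrable_eval ρ (X ^ (k : ℕ))
  have hσ := integrable_eval σ (X ^ (k : ℕ))
  simp only [eval_pow, eval_X] at hρ hσ
  simp only [truncatedMoments, ProbabilityMeasure.coe_mk, Pi.add_apply, Pi.smul_apply, smul_eq_mul]
  rw [integral_add_measure (hρ.smul_measure ENNReal.ofReal_ne_top)
    (hσ.smul_measure ENNReal.ofReal_ne_top), integral_smul_measure, integral_smul_measure,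
    ENNReal.toReal_ofReal ha, ENNReal.toReal_ofReal hb]
  rfl

/-- A real sequence whose functional is nonnegative on the polynomials that are nonnegative on
`[0, ν]` is a sequence of moments: the truncated version of the Riesz-Haviland theorem. -/
theorem mem_range_truncatedMoments {ν : ℝ} {d : ℕ} {m : Fin (d + 1) → ℝ} (hm : m 0 = 1)
    (h : ∀ p : ℝ[X], p.natDegree ≤ d → (∀ t ∈ Set.Icc 0 ν, 0 ≤ p.eval t) →
      0 ≤ momentFunctional m p) : m ∈ Set.range (truncatedMoments (ν := ν) d) := by
  by_contra hmem
  obtain ⟨f, u, hfu, hu⟩ := geometric_hahn_banach_point_closed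
    (convex_range_truncatedMoments ν d)
    (isCompact_range (continuous_truncatedMoments ν d)).isClosed hmem
  have hf (x : Fin (d + 1) → ℝ) : f x = ∑ k, x k * f (Pi.single k 1) := by
    conv_lhs => rw [← Finset.univ_sum_single x]
    rw [map_sum]
    refine Finset.sum_congr rfl fun k _ => ?_
    rw [← smul_eq_mul, ← map_smul, ← Pi.single_smul, smul_eq_mul, mul_one]
  -- The separating hyperplane, read as a polynomial: its value under the functional is `f m - u <
  -- 0`, because `m 0 = 1`.
  have h1 := h (∑ k : Fin (d + 1), f (Pi.single k 1) • X ^ (k : ℕ) - C u) ?_ ?_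
  · rw [map_sub, map_sum, ← mul_one (C u), ← smul_eq_C_mul, map_smul] at h1
    have h0 := momentFunctional_X_pow m 0
    simp only [map_smul, momentFunctional_X_pow, smul_eq_mul] at h1
    simp only [Fin.val_zero, pow_zero] at h0
    rw [h0, hm] at h1
    have h2 := hf m
    simp only [mul_comm (m _)] at h2
    linarith
  · rw [natDegree_sub_C]
    refine natDegree_sum_le_of_forall_le _ _ fun k _ => (natDegree_smul_le _ _).trans ?_
    rw [natDegree_X_pow]
    exact Nat.lt_succ_iff.1 k.2
  · intro t ht
    -- The moment vector of the Dirac measure at `t` turns the separation into positivity at `t`.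
    have h3 := hu _ ⟨⟨Measure.dirac ⟨t, ht⟩, inferInstance⟩, rfl⟩
    rw [hf] at h3
    simp only [truncatedMoments, ProbabilityMeasure.coe_mk, integral_dirac] at h3
    simp only [eval_sub, eval_finsetSum, eval_smul, eval_pow, eval_X, eval_C, smul_eq_mul,
      mul_comm (f _)]
    linarith

/-- Polarization: `2 w t^(i+j) = w (t^i + t^j)² - w t^(2i) - w t^(2j)`, and each `k ≤ 2 (N - 1)` is
a sum of two exponents below `N`. -/
theorem momentFunctional_mul_X_pow_eq_zero {d : ℕ} {m : Fin (d + 1) → ℝ} {w : ℝ[X]} {N k : ℕ}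
    (h : ∀ q : ℝ[X], q.degree < (N : ℕ) → momentFunctional m (w * q ^ 2) = 0)
    (hN : 0 < N) (hk : k ≤ 2 * (N - 1)) : momentFunctional m (w * X ^ k) = 0 := by
  obtain ⟨i, j, hi, hj, rfl⟩ : ∃ i j, i < N ∧ j < N ∧ k = i + j :=
    ⟨min k (N - 1), k - min k (N - 1), by omega, by omega, by omega⟩
  have hdeg {l : ℕ} (hl : l < N) : (X ^ l : ℝ[X]).degree < (N : ℕ) :=
    (degree_X_pow_le l).trans_lt (by exact_mod_cast hl)
  have h1 := h _ (hdeg hi)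
  have h2 := h _ (hdeg hj)
  have h3 := h _ ((degree_add_le _ _).trans_lt (max_lt (hdeg hi) (hdeg hj)))
  rw [show w * (X ^ i + X ^ j) ^ 2 =
    w * (X ^ i) ^ 2 + w * (X ^ j) ^ 2 + (2 : ℝ) • (w * X ^ (i + j)) by
      rw [ofNat_smul_eq_nsmul ℝ 2]; ring] at h3
  rw [map_add, map_add, map_smul, h1, h2, smul_eq_mul] at h3
  linarith

/-- At `ν = 0` the weights are `1, -t²` or `t, -t`, so the two matrix inequalities oppose each other
and `L (t² q²)`, respectively `L (t q²)`, vanishes. -/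
theorem eq_zero_of_posSemidef_localizingMatrix_zero {d : ℕ} {m : Fin (d + 1) → ℝ} (hm : m 0 = 1)
    (h : ∀ b, (localizingMatrix 0 m b).PosSemidef) {k : Fin (d + 1)} (hk : k ≠ 0) : m k = 0 := by
  have hk0 : 0 < (k : ℕ) := Nat.pos_of_ne_zero fun h0 => hk (Fin.ext h0)
  have hkd := k.2
  rw [← momentFunctional_X_pow m k]
  have hL0 := fun q => momentFunctional_weight_mul_sq_nonneg (h 0) (q := q)
  have hL1 := fun q => momentFunctional_weight_mul_sq_nonneg (h 1) (q := q)
  by_cases hd : Even d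
  · have hd2 := Nat.even_iff.1 hd
    simp only [locWeight, hd, locSize] at hL0 hL1
    simp at hL0 hL1
    -- The weight `t²` does not reach order one. There, with `x = L t`, the variance `L ((t - x)²) =
    -- L (t²) - x²` is nonnegative while `L (t²) ≤ 0`.
    rcases Nat.lt_or_ge (k : ℕ) 2 with hk2 | hk2
    · have h1 : (k : ℕ) = 1 := by omega
      rw [h1, pow_one]
      have hX2 : momentFunctional m (X ^ 2) ≤ 0 := by
        have := hL1 1 (by rw [degree_one]; exact_mod_cast (show 0 < (d + 1) / 2 by omega))
        simpa [← sq] using this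
      have hC (a : ℝ) : momentFunctional m (C a) = a := by
        have h0 := momentFunctional_X_pow m 0
        rw [Fin.val_zero, pow_zero] at h0
        rw [← mul_one (C a), ← smul_eq_C_mul, map_smul, h0, hm, smul_eq_mul, mul_one]
      set x := momentFunctional m X with hx
      have h2 := hL0 (X - C x) (by
        rw [degree_X_sub_C]
        exact_mod_cast (show 1 < d / 2 + 1 by omega))
      rw [show (X - C x) ^ 2 = X ^ 2 - (2 * x) • X + C (x ^ 2) by
        rw [smul_eq_C_mul, C_mul, C_pow, map_ofNat]; ring, map_add, map_sub, map_smul, hC,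
        ← hx, smul_eq_mul] at h2
      nlinarith [sq_nonneg x]
    · have h2 := momentFunctional_mul_X_pow_eq_zero (m := m) (w := X ^ 2) (N := d / 2)
        (k := k - 2) (fun q hq => ?_) (by omega) (by omega)
      · rwa [← pow_add, Nat.add_sub_cancel' hk2] at h2
      · refine le_antisymm ?_ ?_
        · have := hL1 q (by rwa [show (d + 1) / 2 = d / 2 by omega])
          simpa [sq] using this
        · have := hL0 (X * q) ?_
          · rwa [mul_pow] at this
          · exact_mod_cast degree_mul_lt_of_natDegree_le_one natDegree_X_le hq le_rfl
  · have hd2 := Nat.odd_iff.1 (Nat.not_even_iff_odd.1 hd)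
    simp only [locWeight, hd, locSize] at hL0 hL1
    simp at hL0 hL1
    have h2 := momentFunctional_mul_X_pow_eq_zero (m := m) (w := X) (N := d / 2 + 1)
        (k := k - 1) (fun q hq => ?_) (by omega) (by omega)
    · rwa [← pow_succ', Nat.sub_add_cancel hk0] at h2
    · refine le_antisymm ?_ (hL0 q (by exact_mod_cast hq))
      exact hL1 q (by rwa [show (d + 1) / 2 = d / 2 + 1 by omega])

/-- The **truncated Hausdorff moment problem**. -/
theorem exists_truncatedMoments_eq_iff {ν : ℝ} (hν : 0 ≤ ν) {d : ℕ} (m : Fin (d + 1) → ℝ) :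
    (∃ ρ : ProbabilityMeasure (Set.Icc (0 : ℝ) ν), truncatedMoments d ρ = m) ↔
      m 0 = 1 ∧ ∀ b, (localizingMatrix ν m b).PosSemidef := by
  constructor
  · rintro ⟨ρ, rfl⟩
    exact ⟨truncatedMoments_zero d ρ, fun b => posSemidef_localizingMatrix ρ b⟩
  rintro ⟨hm, h⟩
  rcases hν.eq_or_lt with rfl | hν
  · refine ⟨⟨Measure.dirac ⟨0, le_rfl, le_rfl⟩, inferInstance⟩, funext fun k => ?_⟩
    simp only [truncatedMoments, ProbabilityMeasure.coe_mk, integral_dirac]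
    rcases eq_or_ne k 0 with rfl | hk
    · simp [hm]
    · rw [eq_zero_of_posSemidef_localizingMatrix_zero hm h hk,
        zero_pow fun h0 => hk (Fin.ext h0)]
  · exact mem_range_truncatedMoments hm fun p hp hp0 =>
      momentFunctional_nonneg_of_mem_weightedSquares h (mem_weightedSquares_of_nonneg hν d p hp hp0)

/-! ### Polynomials in the first flow as Gram forms -/

theorem gramEval_add {n D : ℕ} (M N : Matrix (MonIndex n D) (MonIndex n D) ℝ) (x : Fin n → ℝ) :
    gramEval (M + N) x = gramEval M x + gramEval N x := by
  simp [gramEval, add_mul, Finset.sum_add_distrib]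

theorem gramEval_smul {n D : ℕ} (c : ℝ) (M : Matrix (MonIndex n D) (MonIndex n D) ℝ)
    (x : Fin n → ℝ) : gramEval (c • M) x = c * gramEval M x := by
  simp [gramEval, Finset.mul_sum, mul_assoc]

theorem gramEval_single {n D : ℕ} (a b : MonIndex n D) (x : Fin n → ℝ) :
    gramEval (Matrix.single a b 1) x = monVec D x a * monVec D x b := by
  classical
  rw [gramEval, Finset.sum_eq_single a, Finset.sum_eq_single b]
  · simp [Matrix.vecMulVec]
  · intro c _ hc; simp [hc.symm]
  · simp
  · intro c _ hc; simp [hc.symm]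
  · simp

/-- The exponent of the monomial `x_1 ^ i` in two variables. -/
def firstPowIndex (D i : ℕ) (hi : i ≤ D / 2 + 1) : MonIndex 2 D :=
  ⟨![⟨i, by omega⟩, 0], by simpa using hi⟩

theorem monVec_firstPowIndex {D i : ℕ} (hi : i ≤ D / 2 + 1) (x : Fin 2 → ℝ) :
    monVec D x (firstPowIndex D i hi) = x 0 ^ i := by
  simp [monVec, firstPowIndex]

/-- Powers of `x_1` alone suffice: as `D + 1 ≤ 2 (D / 2 + 1)`, each `t^k` needed is a product of two
entries of `z`, and its matrix unit is symmetrized. -/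
theorem exists_gramEval_eq_eval (D : ℕ) (p : ℝ[X]) (hp : p.natDegree ≤ D + 1) :
    ∃ M : Matrix (MonIndex 2 D) (MonIndex 2 D) ℝ, M.IsSymm ∧ ∀ x, gramEval M x = p.eval (x 0) := by
  let S : Submodule ℝ ℝ[X] :=
    { carrier := {p | ∃ M : Matrix (MonIndex 2 D) (MonIndex 2 D) ℝ,
        M.IsSymm ∧ ∀ x, gramEval M x = p.eval (x 0)}
      zero_mem' := ⟨0, Matrix.isSymm_zero, fun x => by simp [gramEval]⟩
      add_mem' := by
        rintro p q ⟨M, hM, hMp⟩ ⟨N, hN, hNq⟩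
        exact ⟨M + N, hM.add hN, fun x => by rw [gramEval_add, hMp, hNq, eval_add]⟩
      smul_mem' := by
        rintro c p ⟨M, hM, hMp⟩
        exact ⟨c • M, hM.smul c, fun x => by rw [gramEval_smul, hMp, eval_smul, smul_eq_mul]⟩ }
  change p ∈ S
  rw [as_sum_range' p (D + 2) (by omega)]
  refine sum_mem fun k hk => ?_
  rw [Finset.mem_range] at hk
  rw [← mul_one (p.coeff k), ← smul_eq_mul, ← smul_monomial, monomial_one_right_eq_X_pow]
  refine S.smul_mem _ ?_
  obtain ⟨i, j, hi, hj, rfl⟩ : ∃ i j, i ≤ D / 2 + 1 ∧ j ≤ D / 2 + 1 ∧ k = i + j :=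
    ⟨min k (D / 2 + 1), k - min k (D / 2 + 1), by omega, by omega, by omega⟩
  refine ⟨(1 / 2 : ℝ) • (Matrix.single (firstPowIndex D i hi) (firstPowIndex D j hj) 1 +
    Matrix.single (firstPowIndex D j hj) (firstPowIndex D i hi) 1), ?_, fun x => ?_⟩
  · refine Matrix.IsSymm.smul ?_ _
    rw [Matrix.IsSymm, Matrix.transpose_add, Matrix.transpose_single, Matrix.transpose_single,
      add_comm]
  · rw [gramEval_smul, gramEval_add, gramEval_single, gramEval_single, monVec_firstPowIndex,
      monVec_firstPowIndex, eval_pow, eval_X, pow_add]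
    ring

/-! ### The integrands as univariate polynomials -/

namespace RoutingGame

variable {Ω : Type*} [Fintype Ω] {D : ℕ} (G : RoutingGame Ω 2 D) (ν : ℝ) (y : Fin 2 → ℝ)

theorem natDegree_recFlowPoly_le (i : Fin 2) : (recFlowPoly ν i).natDegree ≤ 1 := by
  fin_cases i
  · exact natDegree_X_le
  · exact natDegree_C_sub_X_le ν

theorem natDegree_latencyPoly_le (ω : Ω) (i : Fin 2) : (G.latencyPoly ν y ω i).natDegree ≤ D := by
  refine natDegree_sum_le_of_forall_le _ _ fun d _ => (natDegree_C_mul_le _ _).trans ?_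
  refine (natDegree_pow_le_of_le (d : ℕ) (natDegree_add_C.trans_le
    (natDegree_recFlowPoly_le ν i))).trans ?_
  have := d.2
  omega

theorem natDegree_costPoly_le (ω : Ω) : (G.costPoly ν y ω).natDegree ≤ D + 1 := by
  refine (natDegree_C_mul_le _ _).trans ?_
  refine natDegree_sum_le_of_forall_le _ _ fun i _ => natDegree_mul_le.trans ?_
  have h1 := natDegree_recFlowPoly_le ν i
  have h2 := G.natDegree_latencyPoly_le ν y ω i
  rw [natDegree_add_C]
  omega

theorem natDegree_latencyPoly_sub_le (ω : Ω) (i j : Fin 2) :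
    (G.latencyPoly ν y ω j - G.latencyPoly ν y ω i).natDegree ≤ D :=
  (natDegree_sub_le _ _).trans
    (max_le (G.natDegree_latencyPoly_le ν y ω j) (G.natDegree_latencyPoly_le ν y ω i))

theorem natDegree_obediencePoly_le (i j : Fin 2) (ω : Ω) :
    (G.obediencePoly ν y i j ω).natDegree ≤ D + 1 :=
  (natDegree_C_mul_le _ _).trans (natDegree_mul_le.trans (Nat.add_le_add
    (G.natDegree_latencyPoly_sub_le ν y ω i j) (natDegree_recFlowPoly_le ν i)))

theorem natDegree_nashPoly_le (i j : Fin 2) (ω : Ω) :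
    (G.nashPoly ν y i j ω).natDegree ≤ D + 1 :=
  (natDegree_C_mul_le _ _).trans ((natDegree_mul_C_le _ _).trans
    ((G.natDegree_latencyPoly_sub_le ν y ω i j).trans (Nat.le_succ D)))

variable {ν}

theorem eval_recFlowPoly {x : Fin 2 → ℝ} (hx : x ∈ flowSimplex 2 ν) (i : Fin 2) :
    (recFlowPoly ν i).eval (x 0) = x i := by
  have h := hx.2
  rw [Fin.sum_univ_two] at h
  fin_cases i
  · simp [recFlowPoly]
  · simp [recFlowPoly, ← h]

theorem eval_latencyPoly {x : Fin 2 → ℝ} (hx : x ∈ flowSimplex 2 ν) (ω : Ω) (i : Fin 2) :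
    (G.latencyPoly ν y ω i).eval (x 0) = G.latency ω i (x i + y i) := by
  simp [latencyPoly, latency, eval_finsetSum, eval_recFlowPoly hx]

theorem eval_costPoly {x : Fin 2 → ℝ} (hx : x ∈ flowSimplex 2 ν) (ω : Ω) :
    (G.costPoly ν y ω).eval (x 0) = G.costIntegrand y ω x := by
  simp only [costPoly, costIntegrand, eval_mul, eval_C, eval_finsetSum, eval_add,
    eval_recFlowPoly hx, G.eval_latencyPoly y hx]

theorem eval_obediencePoly {x : Fin 2 → ℝ} (hx : x ∈ flowSimplex 2 ν) (i j : Fin 2) (ω : Ω) :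
    (G.obediencePoly ν y i j ω).eval (x 0) = G.obedienceIntegrand y i j ω x := by
  simp only [obediencePoly, obedienceIntegrand, eval_mul, eval_C, eval_sub,
    eval_recFlowPoly hx, G.eval_latencyPoly y hx]

theorem eval_nashPoly {x : Fin 2 → ℝ} (hx : x ∈ flowSimplex 2 ν) (i j : Fin 2) (ω : Ω) :
    (G.nashPoly ν y i j ω).eval (x 0) = G.nashIntegrand y i j ω x := by
  simp only [nashPoly, nashIntegrand, eval_mul, eval_C, eval_sub, G.eval_latencyPoly y hx]

variable (ν)

theorem exists_represents : ∃ P : MomentProblem Ω 2 D, P.Represents G ν y := by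
  choose C hC hC' using fun ω => exists_gramEval_eq_eval D _ (G.natDegree_costPoly_le ν y ω)
  choose A hA hA' using fun i j ω =>
    exists_gramEval_eq_eval D _ (G.natDegree_obediencePoly_le ν y i j ω)
  choose B hB hB' using fun i j ω =>
    exists_gramEval_eq_eval D _ (G.natDegree_nashPoly_le ν y i j ω)
  exact ⟨⟨C, A, B⟩, hC, hA, hB, fun ω x hx => (hC' ω x).trans (G.eval_costPoly y hx ω),
    fun i j ω x hx => (hA' i j ω x).trans (G.eval_obediencePoly y hx i j ω),
    fun i j ω x hx => (hB' i j ω x).trans (G.eval_nashPoly y hx i j ω)⟩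

end RoutingGame

/-! ### Reduction to the first link -/

/-- The flow vector with a given flow on the first link. -/
def flowOfFirst (ν : ℝ) (t : Set.Icc (0 : ℝ) ν) : flowSimplex 2 ν :=
  ⟨![t, ν - t], fun i => by
    fin_cases i
    · exact t.2.1
    · exact sub_nonneg.2 t.2.2, by simp⟩

theorem measurable_flowOfFirst (ν : ℝ) : Measurable (flowOfFirst ν) := by
  refine Measurable.subtype_mk (measurable_pi_iff.2 fun i => ?_)
  fin_cases i
  · exact measurable_subtype_coe
  · exact measurable_const.sub measurable_subtype_coe

theorem firstFlow_flowOfFirst (ν : ℝ) : firstFlow ν ∘ flowOfFirst ν = id := by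
  ext t
  simp [firstFlow, flowOfFirst]

theorem flowOfFirst_firstFlow (ν : ℝ) : flowOfFirst ν ∘ firstFlow ν = id := by
  ext x i
  have h := x.2.2
  rw [Fin.sum_univ_two] at h
  fin_cases i
  · simp [firstFlow, flowOfFirst]
  · simp [firstFlow, flowOfFirst, ← h]

theorem bijective_firstLinkLaw (Ω : Type*) (ν : ℝ) :
    Function.Bijective (firstLinkLaw : Policy Ω 2 ν → _) := by
  refine Function.bijective_iff_has_inverse.2
    ⟨fun ρ ω => (ρ ω).map (measurable_flowOfFirst ν).aemeasurable, fun π => ?_, fun ρ => ?_⟩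
  · refine funext fun ω => Subtype.ext ?_
    change Measure.map _ (Measure.map _ _) = _
    rw [Measure.map_map (measurable_flowOfFirst ν) (measurable_firstFlow ν),
      flowOfFirst_firstFlow, Measure.map_id]
    rfl
  · refine funext fun ω => Subtype.ext ?_
    change Measure.map _ (Measure.map _ _) = _
    rw [Measure.map_map (measurable_firstFlow ν) (measurable_flowOfFirst ν),
      firstFlow_flowOfFirst, Measure.map_id]
    rfl

/-- Only values on the simplex enter, so the choice of representing matrices is immaterial. -/
theorem integral_gramEval_eq {Ω : Type*} {ν : ℝ} {D : ℕ} (π : Policy Ω 2 ν) (ω : Ω)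
    {M : Matrix (MonIndex 2 D) (MonIndex 2 D) ℝ} {p : ℝ[X]}
    (h : ∀ x ∈ flowSimplex 2 ν, gramEval M x = p.eval (x 0)) :
    ∫ x, gramEval M x.1 ∂(π ω : Measure (flowSimplex 2 ν)) =
      ∫ t, p.eval (t : ℝ) ∂(firstLinkLaw π ω : Measure (Set.Icc (0 : ℝ) ν)) := by
  rw [firstLinkLaw, ProbabilityMeasure.toMeasure_map]
  refine Eq.trans ?_ (integral_map (measurable_firstFlow ν).aemeasurable
    (p.continuous.comp continuous_subtype_val).aestronglyMeasurable).symm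
  exact integral_congr_ae (.of_forall fun x => h x.1 x.2)

namespace MomentProblem.Represents

variable {Ω : Type*} [Fintype Ω] {D : ℕ} {P : MomentProblem Ω 2 D} {G : RoutingGame Ω 2 D} {ν : ℝ}
  {y : Fin 2 → ℝ}

theorem mem_feasibleSet_iff (hP : P.Represents G ν y) (π : Policy Ω 2 ν) :
    π ∈ P.feasibleSet ν ↔ firstLinkLaw π ∈ G.uniFeasibleSet ν y := by
  have hA (i j : Fin 2) (ω : Ω) := integral_gramEval_eq π ω fun x hx =>
    (hP.obedience_eq i j ω x hx).trans (G.eval_obediencePoly y hx i j ω).symm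
  have hB (i j : Fin 2) (ω : Ω) := integral_gramEval_eq π ω fun x hx =>
    (hP.nash_eq i j ω x hx).trans (G.eval_nashPoly y hx i j ω).symm
  simp only [MomentProblem.feasibleSet, RoutingGame.uniFeasibleSet, Set.mem_ofPred_eq, hA, hB]

theorem cost_eq_uniCost (hP : P.Represents G ν y) (π : Policy Ω 2 ν) :
    P.cost π = G.uniCost ν y (firstLinkLaw π) :=
  Finset.sum_congr rfl fun ω _ => integral_gramEval_eq π ω fun x hx =>
    (hP.cost_eq ω x hx).trans (G.eval_costPoly y hx ω).symm

end MomentProblem.Represents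

/-! ### The semidefinite program -/

section MomentSDP

variable {Ω : Type*} [Fintype Ω] {D : ℕ} (G : RoutingGame Ω 2 D) (ν : ℝ)
  (y : Fin 2 → ℝ)

theorem sum_coeff_mul_eq_sum_momentFunctional (p : Ω → ℝ[X]) (η : Ω × Fin (D + 1 + 1) → ℝ) :
    ∑ v, (p v.1).coeff v.2 * η v = ∑ ω, momentFunctional (fun k => η (ω, k)) (p ω) := by
  simp only [Fintype.sum_prod_type, momentFunctional_apply, mul_comm]

variable [DecidableEq Ω]

theorem sum_smul_ite_localizingCoeff (η : Ω × Fin (D + 1 + 1) → ℝ) (b : Ω × Fin 2) :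
    ∑ v, η v • (if v.1 = b.1 then
        localizingCoeff (locWeight ν (D + 1) b.2) (locSize (D + 1) b.2) v.2 else 0) - 0 =
      localizingMatrix ν (fun k => η (b.1, k)) b.2 := by
  rw [sub_zero, Fintype.sum_prod_type, localizingMatrix, Finset.sum_eq_single b.1]
  · simp
  · intro ω _ hω; simp [hω]
  · simp

/-- Only the obedience and Bayes-Nash inequalities couple the states; the remaining constraints are
the moment conditions, state by state. -/
theorem mem_feasibleSet_momentSDP_iff (η : Ω × Fin (D + 1 + 1) → ℝ) :
    η ∈ (momentSDP G ν y).feasibleSet ↔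
      (∀ ω, η (ω, 0) = 1 ∧ ∀ b, (localizingMatrix ν (fun k => η (ω, k)) b).PosSemidef) ∧
      (∀ i j, 0 ≤ ∑ ω, momentFunctional (fun k => η (ω, k)) (G.obediencePoly ν y i j ω)) ∧
      (∀ i j, 0 ≤ ∑ ω, momentFunctional (fun k => η (ω, k)) (G.nashPoly ν y i j ω)) := by
  have hlmi (b : Ω × Fin 2) :
      ∑ v, η v • (momentSDP G ν y).lmiCoeff b v - (momentSDP G ν y).lmiRhs b =
        localizingMatrix ν (fun k => η (b.1, k)) b.2 :=
    sum_smul_ite_localizingCoeff ν η b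
  have heq (ω : Ω) : ∑ v, (momentSDP G ν y).eqCoeff ω v * η v = η (ω, 0) := by
    simp [momentSDP]
  have hobed (i j : Fin 2) :
      ∑ v, (momentSDP G ν y).ineqCoeff (.inl (i, j)) v * η v =
        ∑ ω, momentFunctional (fun k => η (ω, k)) (G.obediencePoly ν y i j ω) :=
    sum_coeff_mul_eq_sum_momentFunctional (G.obediencePoly ν y i j) η
  have hnash (i j : Fin 2) :
      ∑ v, (momentSDP G ν y).ineqCoeff (.inr (i, j)) v * η v =
        ∑ ω, momentFunctional (fun k => η (ω, k)) (G.nashPoly ν y i j ω) :=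
    sum_coeff_mul_eq_sum_momentFunctional (G.nashPoly ν y i j) η
  constructor
  · rintro ⟨h1, h2, h3⟩
    refine ⟨fun ω => ⟨(heq ω).symm.trans (h1 ω), fun b => hlmi (ω, b) ▸ h3 (ω, b)⟩,
      fun i j => hobed i j ▸ h2 (.inl (i, j)), fun i j => hnash i j ▸ h2 (.inr (i, j))⟩
  · rintro ⟨h1, h2, h3⟩
    refine ⟨fun ω => (heq ω).trans (h1 ω).1, ?_, fun b => hlmi b ▸ (h1 b.1).2 b.2⟩
    rintro (⟨i, j⟩ | ⟨i, j⟩)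
    · exact (hobed i j).symm ▸ h2 i j
    · exact (hnash i j).symm ▸ h3 i j

theorem mem_uniFeasibleSet_iff (ρ : Ω → ProbabilityMeasure (Set.Icc (0 : ℝ) ν)) :
    ρ ∈ G.uniFeasibleSet ν y ↔ momentVector D ρ ∈ (momentSDP G ν y).feasibleSet := by
  have hA (i j : Fin 2) (ω : Ω) :=
    integral_eval_eq_momentFunctional (ρ ω) (G.natDegree_obediencePoly_le ν y i j ω)
  have hB (i j : Fin 2) (ω : Ω) :=
    integral_eval_eq_momentFunctional (ρ ω) (G.natDegree_nashPoly_le ν y i j ω)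
  rw [mem_feasibleSet_momentSDP_iff, and_iff_right fun ω =>
    ⟨truncatedMoments_zero (D + 1) (ρ ω), fun b => posSemidef_localizingMatrix (ρ ω) b⟩]
  simp only [RoutingGame.uniFeasibleSet, Set.mem_ofPred_eq, hA, hB]
  rfl

theorem uniCost_eq_objective (ρ : Ω → ProbabilityMeasure (Set.Icc (0 : ℝ) ν)) :
    G.uniCost ν y ρ = (momentSDP G ν y).objective (momentVector D ρ) := by
  refine Eq.trans ?_ (sum_coeff_mul_eq_sum_momentFunctional (G.costPoly ν y) _).symm
  exact Finset.sum_congr rfl fun ω _ =>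
    integral_eval_eq_momentFunctional (ρ ω) (G.natDegree_costPoly_le ν y ω)

theorem feasibleSet_momentSDP_eq_image {ν : ℝ} (hν : 0 ≤ ν) :
    (momentSDP G ν y).feasibleSet = momentVector D '' G.uniFeasibleSet ν y := by
  ext η
  constructor
  · intro hη
    -- The sufficiency half of the moment problem gives a measure in each state separately.
    choose ρ hρ using fun ω => (exists_truncatedMoments_eq_iff hν fun k => η (ω, k)).2
      (((mem_feasibleSet_momentSDP_iff G ν y η).1 hη).1 ω)
    have h : momentVector D ρ = η := funext fun v => congrFun (hρ v.1) v.2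
    exact ⟨ρ, (mem_uniFeasibleSet_iff G ν y ρ).2 (h ▸ hη), h⟩
  · rintro ⟨ρ, hρ, rfl⟩
    exact (mem_uniFeasibleSet_iff G ν y ρ).1 hρ

end MomentSDP

/-! ### Transfer of optimal values and solutions -/

section Transfer

variable {X Y : Type*} {f : X → ℝ} {g : Y → ℝ} {S : Set X} {T : Set Y} {Φ : X → Y}

theorem optValue_eq_of_image_eq (hΦ : Φ '' S = T) (hfg : ∀ x, f x = g (Φ x)) :
    optValue f S = optValue g T := by
  simp only [optValue, ← hΦ, iInf_image, hfg]

/-- No injectivity of `Φ` is needed: competitors in `T` are images of competitors in `S` with the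
same value. -/
theorem isOptimal_iff_of_image_eq (hΦ : Φ '' S = T) (hmem : ∀ x, x ∈ S ↔ Φ x ∈ T)
    (hfg : ∀ x, f x = g (Φ x)) (x : X) : IsOptimal f S x ↔ IsOptimal g T (Φ x) := by
  simp only [IsOptimal, hmem x, hfg]
  rw [← hΦ, Set.forall_mem_image]

theorem exists_isOptimal_of_image_eq (hΦ : Φ '' S = T) (hmem : ∀ x, x ∈ S ↔ Φ x ∈ T)
    (hfg : ∀ x, f x = g (Φ x)) {η : Y} (h : IsOptimal g T η) :
    ∃ x, IsOptimal f S x ∧ Φ x = η := by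
  obtain ⟨x, -, rfl⟩ := hΦ.symm ▸ h.1
  exact ⟨x, (isOptimal_iff_of_image_eq hΦ hmem hfg x).2 h, rfl⟩

end Transfer

theorem proposition1 {Ω : Type*} [Fintype Ω] [DecidableEq Ω] {D : ℕ} (G : RoutingGame Ω 2 D)
    (ν : ℝ) (hν : ν ∈ Set.Icc (0 : ℝ) 1) (y : Fin 2 → ℝ) (hy : y ∈ flowSimplex 2 (1 - ν)) :
    -- the problem can be written as a generalized problem of moments
    (∃ P : MomentProblem Ω 2 D, P.Represents G ν y) ∧
    -- univariate truncated moment sequences on `[0, ν]`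
    (∀ m : Fin (D + 1 + 1) → ℝ,
      (∃ ρ : ProbabilityMeasure (Set.Icc (0 : ℝ) ν), truncatedMoments (D + 1) ρ = m) ↔
        m 0 = 1 ∧ ∀ b, (localizingMatrix ν m b).PosSemidef) ∧
    ∀ P : MomentProblem Ω 2 D, P.Represents G ν y →
      -- policies correspond to families of measures on `[0, ν]`
      Function.Bijective (firstLinkLaw : Policy Ω 2 ν → _) ∧
      (∀ π : Policy Ω 2 ν,
        (π ∈ P.feasibleSet ν ↔ firstLinkLaw π ∈ G.uniFeasibleSet ν y) ∧
        P.cost π = G.uniCost ν y (firstLinkLaw π)) ∧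
      -- feasible points of the semidefinite program are the moment vectors of feasible families
      (momentSDP G ν y).feasibleSet = momentVector D '' G.uniFeasibleSet ν y ∧
      (∀ ρ : Ω → ProbabilityMeasure (Set.Icc (0 : ℝ) ν),
        (ρ ∈ G.uniFeasibleSet ν y ↔ momentVector D ρ ∈ (momentSDP G ν y).feasibleSet) ∧
        G.uniCost ν y ρ = (momentSDP G ν y).objective (momentVector D ρ)) ∧
      -- equal optimal values, and correspondence of optimal solutions
      optValue P.cost (P.feasibleSet ν) =
        optValue (momentSDP G ν y).objective (momentSDP G ν y).feasibleSet ∧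
      (∀ π : Policy Ω 2 ν, IsOptimal P.cost (P.feasibleSet ν) π ↔
        IsOptimal (momentSDP G ν y).objective (momentSDP G ν y).feasibleSet
          (momentVector D (firstLinkLaw π))) ∧
      (∀ η, IsOptimal (momentSDP G ν y).objective (momentSDP G ν y).feasibleSet η →
        ∃ π : Policy Ω 2 ν, IsOptimal P.cost (P.feasibleSet ν) π ∧
          momentVector D (firstLinkLaw π) = η) := by
  refine ⟨G.exists_represents ν y, exists_truncatedMoments_eq_iff hν.1, fun P hP => ?_⟩
  have hbij := bijective_firstLinkLaw Ω ν
  have hfeas := feasibleSet_momentSDP_eq_image G y hν.1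
  have hmem (π : Policy Ω 2 ν) : π ∈ P.feasibleSet ν ↔
      momentVector D (firstLinkLaw π) ∈ (momentSDP G ν y).feasibleSet :=
    (hP.mem_feasibleSet_iff π).trans (mem_uniFeasibleSet_iff G ν y _)
  have hcost (π : Policy Ω 2 ν) : P.cost π =
      (momentSDP G ν y).objective (momentVector D (firstLinkLaw π)) :=
    (hP.cost_eq_uniCost π).trans (uniCost_eq_objective G ν y _)
  have himage : (fun π : Policy Ω 2 ν => momentVector D (firstLinkLaw π)) '' P.feasibleSet ν =
      (momentSDP G ν y).feasibleSet := by
    ext η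
    constructor
    · rintro ⟨π, hπ, rfl⟩
      exact (hmem π).1 hπ
    · intro hη
      obtain ⟨ρ, hρ, rfl⟩ := hfeas ▸ hη
      obtain ⟨π, rfl⟩ := hbij.2 ρ
      exact ⟨π, (hP.mem_feasibleSet_iff π).2 hρ, rfl⟩
  exact ⟨hbij, fun π => ⟨hP.mem_feasibleSet_iff π, hP.cost_eq_uniCost π⟩, hfeas,
    fun ρ => ⟨mem_uniFeasibleSet_iff G ν y ρ, uniCost_eq_objective G ν y ρ⟩,
    optValue_eq_of_image_eq himage hcost, isOptimal_iff_of_image_eq himage hmem hcost,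
    fun η hη => exists_isOptimal_of_image_eq himage hmem hcost hη⟩
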